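/- Let $M$ be a smooth ($C^\infty$, Hausdorff, second countable, finite-dimensional) manifold without boundary. An \emph{almost regular foliation} $E$ on $M$ is an involutive $C^\infty(M)$-submodule $E\subset\mathfrak X(M)$ that is locally free of finite rank: near every point, finitely many elements of $E$ form a basis of $E$ over the smooth functions. Let $A={}^E\!A\to M$ be its Lie algebroid: its fibre at $x$ is $A_x=E/I_xE$ with $I_x=\{f\in C^\infty(M): f(x)=0\}$, its anchor $\rho:A\to TM$ is induced by evaluation of vector fields, and its bracket is the Lie bracket of $E$. The $E$-forms are the smooth sections of $\wedge^\bullet A^*$, with differential $d$ given by the Cartan formula; for a one-form, $d\alpha(X,Y)=\rho(X)(\alpha(Y))-\rho(Y)(\alpha(X))-\alpha([X,Y])$. An \emph{$E$-symplectic form} is a smooth, fibrewise non-degenerate $\omega\in\Gamma(\wedge^2A^*)$ with $d\omega=0$. It makes $A^*$ a Lie algebroid: let $\pi^\sharp:A^*\to A$ be the inverse of $v\mapsto\omega(v,\cdot)$ and $\pi(\alpha,\beta)=\omega(\pi^\sharp\alpha,\pi^\sharp\beta)$; the anchor of $A^*$ is $\rho'=\rho\circ\pi^\sharp$ and its bracket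 is $$[\alpha,\beta](X)=\rho'(\alpha)(\beta(X))-\rho'(\beta)(\alpha(X))+[\pi,X](\alpha,\beta),\qquad [\pi,X]=-L_X\pi .$$ A \emph{commutative frame} of $A^*$ over an open set $U$ is a finite family of smooth sections of $A^*|_U$ that is linearly independent at every point of $U$, generates $\Gamma(A^*|_U)$ over $C^\infty(U)$, and whose members have pairwise vanishing brackets on $U$. \textbf{Proposition.} Let $E$ be an almost regular foliation on $M$, $\omega$ an $E$-symplectic form, and $U\subset M$ an open set over which $A$ has constant rank $2k$. Suppose that $\alpha_1,\dots,\alpha_k,\beta_1,\dots,\beta_k\in\Gamma(A^*|_U)$ satisfy $\omega|_U=\sum_{i=1}^k\alpha_i\wedge\beta_i$. Then all the $\alpha_i$ and $\beta_i$ are closed on $U$ (that is, $d\alpha_i=d\beta_i=0$) if and only if $(\alpha_1,\dots,\alpha_k,\beta_1,\dots,\beta_k)$ is a commutative frame of $A^*$ over $U$. \textbf{Corollary.} Let $Z\subset M$ be an embedded submanifold of codimension one, and let $E^0$ be the module of all smooth vector fields on $M$ that vanish along $Z$, so that ${}^{E^0}\!A$ is the $0$-tangent bundle. Let $\omega$ be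 an $E^0$-symplectic form and $U\subset M$ an open set that meets $Z$. Then there are no finite families $\alpha_1,\dots,\alpha_m,\beta_1,\dots,\beta_m$ of closed smooth sections of $({}^{E^0}\!A)^*|_U$ with $\omega|_U=\sum_{i=1}^m\alpha_i\wedge\beta_i$. -/

import Mathlib

open scoped Manifold ContDiff

noncomputable section

namespace EGeom

/-- Vector fields (without regularity condition) on a manifold modelled on `ℝⁿ`. -/
abbrev VField (n : ℕ) (M : Type*) [TopologicalSpace M] [ChartedSpace (EuclideanSpace ℝ (Fin n)) M] :
    Type _ :=
  (x : M) → TangentSpace (𝓡 n) x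

/-- An involutive `C^∞(M)`-submodule `E` of the smooth vector fields on `M`. -/
structure InvolutiveModule (n : ℕ) (M : Type*) [TopologicalSpace M]
    [ChartedSpace (EuclideanSpace ℝ (Fin n)) M] [IsManifold (𝓡 n) ∞ M] where
  /-- the underlying real vector space of vector fields -/
  fields : Submodule ℝ (VField n M)
  smooth : ∀ X ∈ fields, ContMDiff (𝓡 n) (𝓡 n).tangent ∞
    (fun x => (⟨x, X x⟩ : TangentBundle (𝓡 n) M))
  smul_mem : ∀ f : M → ℝ, ContMDiff (𝓡 n) 𝓘(ℝ) ∞ f → ∀ X ∈ fields, f • X ∈ fields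
  lie_mem : ∀ X ∈ fields, ∀ Y ∈ fields, VectorField.mlieBracket (𝓡 n) X Y ∈ fields

variable {n : ℕ} {M : Type*} [TopologicalSpace M]
  [ChartedSpace (EuclideanSpace ℝ (Fin n)) M] [IsManifold (𝓡 n) ∞ M]

namespace InvolutiveModule

/-- `E` is an almost regular foliation: the module is locally free of finite rank, that is, near
every point some finite family of elements of `E` is a basis of `E` over the smooth functions. -/
def IsAlmostRegular (E : InvolutiveModule n M) : Prop :=
  ∀ p : M, ∃ V : TopologicalSpace.Opens M, p ∈ V ∧ ∃ (r : ℕ) (X : Fin r → E.fields),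
    (∀ Y : E.fields, ∃ f : Fin r → M → ℝ, (∀ i, ContMDiffOn (𝓡 n) 𝓘(ℝ) ∞ (f i) V) ∧
      ∀ x ∈ V, (Y : VField n M) x = ∑ i, f i x • (X i : VField n M) x) ∧
    (∀ f : Fin r → M → ℝ, (∀ i, ContMDiffOn (𝓡 n) 𝓘(ℝ) ∞ (f i) V) →
      (∀ x ∈ V, ∑ i, f i x • (X i : VField n M) x = 0) → ∀ i, ∀ x ∈ V, f i x = 0)

/-- Multiplication of an element of `E` by a smooth function. -/
def fsmul (E : InvolutiveModule n M) (f : M → ℝ) (hf : ContMDiff (𝓡 n) 𝓘(ℝ) ∞ f)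
    (X : E.fields) : E.fields :=
  ⟨f • (X : VField n M), E.smul_mem f hf X X.2⟩

/-- The Lie bracket on `E`. -/
def lie (E : InvolutiveModule n M) (X Y : E.fields) : E.fields :=
  ⟨VectorField.mlieBracket (𝓡 n) (X : VField n M) (Y : VField n M), E.lie_mem X X.2 Y Y.2⟩

/-- The submodule `I_x E` of `E`, where `I_x` is the ideal of smooth functions vanishing at `x`. -/
def idealMul (E : InvolutiveModule n M) (x : M) : Submodule ℝ E.fields :=
  Submodule.span ℝ {Y | ∃ (f : M → ℝ) (hf : ContMDiff (𝓡 n) 𝓘(ℝ) ∞ f) (X : E.fields),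
    f x = 0 ∧ Y = E.fsmul f hf X}

/-- The fibre `E / I_x E` at `x` of the `E`-tangent bundle `A` (the Lie algebroid of `E`). -/
abbrev Fiber (E : InvolutiveModule n M) (x : M) : Type _ := E.fields ⧸ E.idealMul x

/-- The value at `x` of `X ∈ E`, seen as a section of `A`. -/
def val (E : InvolutiveModule n M) (x : M) : E.fields →ₗ[ℝ] E.Fiber x := (E.idealMul x).mkQ

/-- The anchor `ρ : A → TM`, induced by evaluating vector fields. -/
def anchor (E : InvolutiveModule n M) (x : M) : E.Fiber x →ₗ[ℝ] TangentSpace (𝓡 n) x :=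
  (E.idealMul x).liftQ ((LinearMap.proj x).comp E.fields.subtype) (by
    rw [idealMul, Submodule.span_le]
    rintro Y ⟨f, hf, X, hfx, rfl⟩
    simp [fsmul, hfx])

/-- A smooth section of `A^*` over the open set `U`, that is, an `E`-form of degree one on `U`
(the values outside `U` play no role). -/
structure OneForm (E : InvolutiveModule n M) (U : TopologicalSpace.Opens M) where
  /-- the value at a point -/
  toFun : (x : M) → Module.Dual ℝ (E.Fiber x)
  smooth : ∀ X : E.fields, ContMDiffOn (𝓡 n) 𝓘(ℝ) ∞ (fun x => toFun x (E.val x X)) U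

namespace OneForm

variable {E : InvolutiveModule n M} {U : TopologicalSpace.Opens M}

/-- The function `α(X)`. -/
def app (α : E.OneForm U) (X : E.fields) (x : M) : ℝ := α.toFun x (E.val x X)

/-- `dα = 0` on `U`, where `dα(X, Y) = X(α(Y)) - Y(α(X)) - α([X, Y])`. -/
def IsClosed (α : E.OneForm U) : Prop :=
  ∀ x ∈ U, ∀ X Y : E.fields,
    mvfderiv (𝓡 n) (α.app Y) x ((X : VField n M) x)
      - mvfderiv (𝓡 n) (α.app X) x ((Y : VField n M) x) - α.app (E.lie X Y) x = 0

/-- The value at `x` of `(L_X α)(Y) = X(α(Y)) - α([X, Y])`. -/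
def preLie (α : E.OneForm U) (X Y : E.fields) (x : M) : ℝ :=
  mvfderiv (𝓡 n) (α.app Y) x ((X : VField n M) x) - α.app (E.lie X Y) x

end OneForm

variable {E : InvolutiveModule n M} {U : TopologicalSpace.Opens M}

theorem val_fsmul (f : M → ℝ) (hf : ContMDiff (𝓡 n) 𝓘(ℝ) ∞ f) (X : E.fields) (x : M) :
    E.val x (E.fsmul f hf X) = f x • E.val x X := by
  rw [← map_smul, ← sub_eq_zero, ← map_sub]
  refine (Submodule.Quotient.mk_eq_zero _).2 (Submodule.subset_span
    ⟨fun y => f y - f x, hf.sub contMDiff_const, X, sub_self _, ?_⟩)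
  ext y
  simp [fsmul, sub_smul]

theorem OneForm.app_mdifferentiableAt (α : E.OneForm U) (X : E.fields) {x : M} (hx : x ∈ U) :
    MDifferentiableAt (𝓡 n) 𝓘(ℝ) (α.app X) x :=
  ((α.smooth X).contMDiffAt (U.isOpen.mem_nhds hx)).mdifferentiableAt (by simp)

theorem fields_mdifferentiableAt (X : E.fields) (x : M) :
    MDifferentiableAt (𝓡 n) (𝓡 n).tangent
      (fun y => (⟨y, (X : VField n M) y⟩ : TangentBundle (𝓡 n) M)) x :=
  (E.smooth X X.2).contMDiffAt.mdifferentiableAt (by simp)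

theorem contMDiff_derivative (f : M → ℝ) (hf : ContMDiff (𝓡 n) 𝓘(ℝ) ∞ f) (X : E.fields) :
    ContMDiff (𝓡 n) 𝓘(ℝ) ∞ (fun y => mvfderiv (𝓡 n) f y ((X : VField n M) y)) :=
  (contMDiff_snd_tangentBundle_modelSpace ℝ 𝓘(ℝ)).comp
    ((hf.contMDiff_tangentMap (m := ∞) (by simp)).comp (E.smooth X X.2))

theorem OneForm.preLie_add (α : E.OneForm U) (X Y Z : E.fields) {x : M} (hx : x ∈ U) :
    α.preLie X (Y + Z) x = α.preLie X Y x + α.preLie X Z x := by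
  have h1 : α.app (Y + Z) = α.app Y + α.app Z := by
    funext y; simp [OneForm.app]
  have h2 : E.val x (E.lie X (Y + Z)) = E.val x (E.lie X Y) + E.val x (E.lie X Z) := by
    rw [← map_add]
    congr 1
    ext1
    funext y
    exact VectorField.mlieBracket_add_right (fields_mdifferentiableAt Y y)
      (fields_mdifferentiableAt Z y)
  have h3 : α.app (E.lie X (Y + Z)) x = α.app (E.lie X Y) x + α.app (E.lie X Z) x := by
    simp [OneForm.app, h2]
  rw [OneForm.preLie, h1, h3, mvfderiv_add (α.app_mdifferentiableAt Y hx)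
    (α.app_mdifferentiableAt Z hx), add_apply, OneForm.preLie, OneForm.preLie]
  ring

theorem OneForm.preLie_fsmul (α : E.OneForm U) (f : M → ℝ) (hf : ContMDiff (𝓡 n) 𝓘(ℝ) ∞ f)
    (X Y : E.fields) {x : M} (hx : x ∈ U) :
    α.preLie X (E.fsmul f hf Y) x = f x * α.preLie X Y x := by
  have hfx : ∀ y, MDifferentiableAt (𝓡 n) 𝓘(ℝ) f y := fun y =>
    hf.contMDiffAt.mdifferentiableAt (by simp)
  have h1 : α.app (E.fsmul f hf Y) = f * α.app Y := by
    funext y; simp [OneForm.app, val_fsmul]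
  have h2 : E.lie X (E.fsmul f hf Y) = E.fsmul f hf (E.lie X Y) +
      E.fsmul _ (contMDiff_derivative f hf X) Y := by
    ext1
    funext y
    have := VectorField.mlieBracket_smul_right (V := (X : VField n M)) (hfx y)
      (fields_mdifferentiableAt Y y)
    rw [add_comm] at this
    exact this
  have h3 : α.app (E.lie X (E.fsmul f hf Y)) x = f x * α.app (E.lie X Y) x +
      mvfderiv (𝓡 n) f x ((X : VField n M) x) * α.app Y x := by
    simp [OneForm.app, h2, val_fsmul]
  rw [OneForm.preLie, h1, h3, mvfderiv_mul (hfx x) (α.app_mdifferentiableAt Y hx), OneForm.preLie]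
  simp
  ring

theorem OneForm.preLie_smul (α : E.OneForm U) (c : ℝ) (X Y : E.fields) {x : M} (hx : x ∈ U) :
    α.preLie X (c • Y) x = c * α.preLie X Y x :=
  α.preLie_fsmul (fun _ => c) contMDiff_const X Y hx

open Classical in
/-- The Lie derivative `L_X α` of a one-form along `X ∈ E`, given by
`(L_X α)(Y) = X(α(Y)) - α([X, Y])` (and by `0` outside `U`). -/
def OneForm.lieDeriv (α : E.OneForm U) (X : E.fields) (x : M) : Module.Dual ℝ (E.Fiber x) :=
  if hx : x ∈ U then
    (E.idealMul x).liftQ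
      { toFun := fun Y => α.preLie X Y x
        map_add' := fun Y Z => α.preLie_add X Y Z hx
        map_smul' := fun c Y => α.preLie_smul c X Y hx } (by
      rw [idealMul, Submodule.span_le]
      rintro Y ⟨f, hf, Z, hfx, rfl⟩
      simp [α.preLie_fsmul f hf X Z hx, hfx])
  else 0

theorem OneForm.lieDeriv_val (α : E.OneForm U) (X Y : E.fields) {x : M} (hx : x ∈ U) :
    α.lieDeriv X x (E.val x Y) = mvfderiv (𝓡 n) (α.app Y) x ((X : VField n M) x)
      - α.app (E.lie X Y) x := by
  rw [OneForm.lieDeriv, dif_pos hx]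
  rfl

/-- An `E`-symplectic form: a smooth, alternating, fibrewise non-degenerate (`A → A^*` is an
isomorphism) and closed section of `Λ² A^*` over `M`. -/
structure SymplecticForm (E : InvolutiveModule n M) where
  /-- the value at a point, `v ↦ Ω_x(v, ·)` -/
  form : (x : M) → E.Fiber x →ₗ[ℝ] Module.Dual ℝ (E.Fiber x)
  smooth : ∀ X Y : E.fields,
    ContMDiff (𝓡 n) 𝓘(ℝ) ∞ (fun x => form x (E.val x X) (E.val x Y))
  alternating : ∀ x v, form x v v = 0
  nondegenerate : ∀ x, Function.Bijective (form x)
  closed : ∀ (x : M) (X Y Z : E.fields),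
    mvfderiv (𝓡 n) (fun y => form y (E.val y Y) (E.val y Z)) x ((X : VField n M) x)
      - mvfderiv (𝓡 n) (fun y => form y (E.val y X) (E.val y Z)) x ((Y : VField n M) x)
      + mvfderiv (𝓡 n) (fun y => form y (E.val y X) (E.val y Y)) x ((Z : VField n M) x)
      - form x (E.val x (E.lie X Y)) (E.val x Z)
      + form x (E.val x (E.lie X Z)) (E.val x Y)
      - form x (E.val x (E.lie Y Z)) (E.val x X) = 0

namespace SymplecticForm

/-- The isomorphism `π^♯ : A^* → A`, inverse to `v ↦ Ω(v, ·)`. -/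
def sharp (Ω : E.SymplecticForm) (x : M) : Module.Dual ℝ (E.Fiber x) ≃ₗ[ℝ] E.Fiber x :=
  (LinearEquiv.ofBijective (Ω.form x) (Ω.nondegenerate x)).symm

/-- The bivector dual to `Ω`: `π(a, b) = Ω(π^♯ a, π^♯ b)`. -/
def bivector (Ω : E.SymplecticForm) (x : M) (a b : Module.Dual ℝ (E.Fiber x)) : ℝ :=
  Ω.form x (Ω.sharp x a) (Ω.sharp x b)

/-- The Lie derivative of the bivector,
`(L_X π)(α, β) = X(π(α, β)) - π(L_X α, β) - π(α, L_X β)`; it equals the Schouten bracket `[X, π]`,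
so that `[π, X] = - L_X π`. -/
def lieBivector (Ω : E.SymplecticForm) (X : E.fields) (α β : E.OneForm U) (x : M) : ℝ :=
  mvfderiv (𝓡 n) (fun y => Ω.bivector y (α.toFun y) (β.toFun y)) x ((X : VField n M) x)
    - Ω.bivector x (α.lieDeriv X x) (β.toFun x) - Ω.bivector x (α.toFun x) (β.lieDeriv X x)

/-- The Lie bracket of the Lie algebroid `A^*` with anchor `ρ' = ρ ∘ π^♯`:
`[α, β](X) = ρ'(α)(β(X)) - ρ'(β)(α(X)) + [π, X](α, β)`. -/
def coBracket (Ω : E.SymplecticForm) (α β : E.OneForm U) (X : E.fields) (x : M) : ℝ :=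
  mvfderiv (𝓡 n) (β.app X) x (E.anchor x (Ω.sharp x (α.toFun x)))
    - mvfderiv (𝓡 n) (α.app X) x (E.anchor x (Ω.sharp x (β.toFun x)))
    - Ω.lieBivector X α β x

/-- `Ω = ∑ i, α i ∧ β i` on `U`. -/
def IsSplit (Ω : E.SymplecticForm) {k : ℕ} (α β : Fin k → E.OneForm U) : Prop :=
  ∀ x ∈ U, ∀ u v : E.Fiber x, Ω.form x u v =
    ∑ i, ((α i).toFun x u * (β i).toFun x v - (α i).toFun x v * (β i).toFun x u)

/-- The family `θ` is a commutative frame of `A^*` over `U`: it is linearly independent at every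
point, it generates the smooth sections of `A^*` over `U` as a `C^∞(U)`-module, and its members
commute for the Lie bracket of `A^*`. -/
def IsCommutativeFrame (Ω : E.SymplecticForm) {ι : Type*} [Fintype ι] (θ : ι → E.OneForm U) :
    Prop :=
  (∀ x ∈ U, LinearIndependent ℝ (fun j => (θ j).toFun x)) ∧
  (∀ κ : E.OneForm U, ∃ f : ι → M → ℝ, (∀ j, ContMDiffOn (𝓡 n) 𝓘(ℝ) ∞ (f j) U) ∧
    ∀ x ∈ U, κ.toFun x = ∑ j, f j x • (θ j).toFun x) ∧
  (∀ i j, ∀ x ∈ U, ∀ X : E.fields, Ω.coBracket (θ i) (θ j) X x = 0)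

end SymplecticForm

end InvolutiveModule

/-- `Z` is an embedded submanifold of codimension one: near each of its points there is a chart of
`M` in which `Z` is the zero set of one of the coordinates. -/
def IsHypersurface (n : ℕ) {M : Type*} [TopologicalSpace M]
    [ChartedSpace (EuclideanSpace ℝ (Fin n)) M] (Z : Set M) : Prop :=
  ∀ p ∈ Z, ∃ φ ∈ IsManifold.maximalAtlas (𝓡 n) ∞ M, p ∈ φ.source ∧
    ∃ i : Fin n, ∀ q ∈ φ.source, q ∈ Z ↔ φ q i = 0

/-- The module of the smooth vector fields on `M` that vanish along `Z`. For a hypersurface `Z` its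
Lie algebroid is the `0`-tangent bundle. -/
def zeroModule (n : ℕ) {M : Type*} [TopologicalSpace M]
    [ChartedSpace (EuclideanSpace ℝ (Fin n)) M] [IsManifold (𝓡 n) ∞ M] (Z : Set M) :
    InvolutiveModule n M where
  fields :=
    { carrier := {X | ContMDiff (𝓡 n) (𝓡 n).tangent ∞
        (fun x => (⟨x, X x⟩ : TangentBundle (𝓡 n) M)) ∧ ∀ x ∈ Z, X x = 0}
      add_mem' := fun {X Y} hX hY =>
        ⟨hX.1.add_section hY.1, fun x hx => by simp [hX.2 x hx, hY.2 x hx]⟩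
      zero_mem' := ⟨Bundle.contMDiff_zeroSection ℝ (TangentSpace (𝓡 n)), fun _ _ => rfl⟩
      smul_mem' := fun c X hX =>
        ⟨hX.1.const_smul_section, fun x hx => by simp [hX.2 x hx]⟩ }
  smooth := fun _ hX => hX.1
  smul_mem := fun f hf X hX => ⟨hf.smul_section hX.1, fun x hx => by simp [hX.2 x hx]⟩
  lie_mem := fun X hX Y hY => by
    have : IsManifold (𝓡 n) (((⊤ : ℕ∞) : WithTop ℕ∞) + 1) M := by simpa
    have : IsManifold (𝓡 n) (minSmoothness ℝ 2) M := by
      rw [minSmoothness_of_isRCLikeNormedField]; infer_instance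
    refine ⟨ContDiff.mlieBracket_vectorField hX.1 hY.1 (by simp), fun x hx => ?_⟩
    rw [← VectorField.mlieBracketWithin_univ]
    exact VectorField.mlieBracketWithin_eq_zero_of_eq_zero (hX.2 x hx) (hY.2 x hx)

end EGeom

/-! Proposition. A splitting of length half the rank makes the `α i`, `β i` a dual basis of every
fibre over `U`, so the functions `π(θ i, θ j)` are constants (`IsSplit.exists_bivector_eq`). Then
the derivative of `π(θ i, θ j)` drops out of the bracket, which becomes `[θ i, θ j](X) = dθ i(X, π♯
θ j) - dθ j(X, π♯ θ i)` (`coBracket_eq_contr`). Closed forms therefore commute. Conversely, with `b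
j = π♯ θ j`, commutation says that `T i j l = dθ i(b j, b l)` is symmetric in its first and third
indices. It is antisymmetric in the last two, and such an array vanishes.

Corollary. This part is independent of the proposition. At `p ∈ Z` every element of the module
vanishes, so a closed form kills the value at `p` of every bracket. If `h` vanishes on `Z`, `dh(V) =
1` and `dh(W) = 0` at `p`, then `[hV, hW]` and `hW` have the same value in the fibre at `p`. This
value is nonzero if `W p ≠ 0` (`val_zeroSMul_ne_zero`), yet a closed splitting puts it in the kernel
of the form. Such a `W` exists when `n ≥ 2`. For `n = 1` an alternating form is zero off `Z` near
`p`, hence degenerate at `p` by continuity. -/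

namespace EGeom

/-! ### Smooth functions and linear systems -/

section Functions

variable {n : ℕ} {M : Type*} [TopologicalSpace M] [ChartedSpace (EuclideanSpace ℝ (Fin n)) M]

theorem mvfderiv_eq_zero_of_eventuallyEq_const {f : M → ℝ} {c : ℝ} {x : M}
    (h : f =ᶠ[nhds x] fun _ => c) : mvfderiv (𝓡 n) f x = 0 := by
  have h1 : mfderiv (𝓡 n) 𝓘(ℝ) f x = 0 := h.mfderiv_eq.trans mfderiv_const
  exact h1

theorem contMDiffAt_matrix_det {ι : Type*} [Fintype ι] [DecidableEq ι]
    {A : M → Matrix ι ι ℝ} {x : M}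
    (hA : ∀ i j, ContMDiffAt (𝓡 n) 𝓘(ℝ) ∞ (fun y => A y i j) x) :
    ContMDiffAt (𝓡 n) 𝓘(ℝ) ∞ (fun y => (A y).det) x := by
  simp_rw [Matrix.det_apply']
  exact contMDiffAt_finsetSum fun σ _ =>
    contMDiffAt_const.mul (contMDiffAt_finsetProd fun i _ => hA _ _)

/-- The solution of a linear system with smooth coefficients is smooth where the determinant does
not vanish. -/
theorem contMDiffAt_of_mulVec_eq {ι : Type*} [Fintype ι] [DecidableEq ι]
    {A : M → Matrix ι ι ℝ} {f b : M → ι → ℝ} {x : M}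
    (hA : ∀ i j, ContMDiffAt (𝓡 n) 𝓘(ℝ) ∞ (fun y => A y i j) x)
    (hb : ∀ i, ContMDiffAt (𝓡 n) 𝓘(ℝ) ∞ (fun y => b y i) x)
    (hdet : (A x).det ≠ 0) (h : ∀ᶠ y in nhds x, (A y).mulVec (f y) = b y) (j : ι) :
    ContMDiffAt (𝓡 n) 𝓘(ℝ) ∞ (fun y => f y j) x := by
  have hd := contMDiffAt_matrix_det hA
  have hc : ContMDiffAt (𝓡 n) 𝓘(ℝ) ∞ (fun y => ((A y).updateCol j (b y)).det) x := by
    refine contMDiffAt_matrix_det fun i l => ?_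
    by_cases hl : l = j
    · subst hl; simpa using hb i
    · simpa [Matrix.updateCol_apply, hl] using hA i l
  refine ((hd.inv₀ hdet).mul hc).congr_of_eventuallyEq ?_
  filter_upwards [h, hd.continuousAt.eventually_ne hdet] with y hy hne
  change f y j = ((A y).det)⁻¹ * ((A y).updateCol j (b y)).det
  -- Cramer's rule: each coordinate of the solution is a quotient of smooth determinants.
  have h2 : (A y).det • f y = (A y).cramer (b y) := by
    rw [Matrix.cramer_eq_adjugate_mulVec, ← hy, Matrix.mulVec_mulVec, Matrix.adjugate_mul,
      Matrix.smul_mulVec, Matrix.one_mulVec]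
  rw [← Matrix.cramer_apply, ← h2]
  simp [hne]

end Functions

variable {n : ℕ} {M : Type*} [TopologicalSpace M]
  [ChartedSpace (EuclideanSpace ℝ (Fin n)) M] [IsManifold (𝓡 n) ∞ M]

/-! ### Contractions, the bracket of `A^*`, and split forms -/

namespace InvolutiveModule

variable {E : InvolutiveModule n M} {U : TopologicalSpace.Opens M}

theorem anchor_val (x : M) (X : E.fields) : E.anchor x (E.val x X) = (X : VField n M) x := rfl

theorem val_surjective (x : M) : Function.Surjective (E.val x) := (E.idealMul x).mkQ_surjective

theorem lie_swap (X Y : E.fields) : E.lie X Y = - E.lie Y X := by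
  ext1
  exact VectorField.mlieBracket_swap

/-- The contraction of `dα` with `X ∈ E`, as a linear form on the fibre at `x`. -/
def OneForm.contr (α : E.OneForm U) (X : E.fields) (x : M) : Module.Dual ℝ (E.Fiber x) :=
  α.lieDeriv X x - (mvfderiv (𝓡 n) (α.app X) x).toLinearMap.comp (E.anchor x)

theorem OneForm.contr_apply (α : E.OneForm U) (X : E.fields) (x : M) (v : E.Fiber x) :
    α.contr X x v = α.lieDeriv X x v - mvfderiv (𝓡 n) (α.app X) x (E.anchor x v) := rfl

theorem OneForm.contr_val (α : E.OneForm U) (X Y : E.fields) {x : M} (hx : x ∈ U) :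
    α.contr X x (E.val x Y) = mvfderiv (𝓡 n) (α.app Y) x ((X : VField n M) x)
      - mvfderiv (𝓡 n) (α.app X) x ((Y : VField n M) x) - α.app (E.lie X Y) x := by
  rw [OneForm.contr_apply, α.lieDeriv_val X Y hx, anchor_val]
  ring

theorem OneForm.contr_swap (α : E.OneForm U) (X Y : E.fields) {x : M} (hx : x ∈ U) :
    α.contr X x (E.val x Y) = - α.contr Y x (E.val x X) := by
  have h : α.app (E.lie X Y) x = - α.app (E.lie Y X) x := by
    rw [lie_swap X Y]; simp [OneForm.app]
  rw [α.contr_val X Y hx, α.contr_val Y X hx, h]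
  ring

theorem OneForm.isClosed_iff_contr (α : E.OneForm U) :
    α.IsClosed ↔ ∀ x ∈ U, ∀ X : E.fields, α.contr X x = 0 := by
  refine forall₂_congr fun x hx => forall_congr' fun X => ?_
  constructor
  · intro h
    refine LinearMap.ext fun v => ?_
    obtain ⟨Y, rfl⟩ := val_surjective x v
    rw [α.contr_val X Y hx, h Y]; rfl
  · intro h Y
    rw [← α.contr_val X Y hx, h]; rfl

namespace SymplecticForm

variable (Ω : E.SymplecticForm)

theorem form_sharp (x : M) (a : Module.Dual ℝ (E.Fiber x)) : Ω.form x (Ω.sharp x a) = a :=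
  (LinearEquiv.ofBijective (Ω.form x) (Ω.nondegenerate x)).apply_symm_apply a

theorem sharp_form (x : M) (v : E.Fiber x) : Ω.sharp x (Ω.form x v) = v :=
  (LinearEquiv.ofBijective (Ω.form x) (Ω.nondegenerate x)).symm_apply_apply v

theorem form_swap (x : M) (u v : E.Fiber x) : Ω.form x u v = - Ω.form x v u := by
  have h := Ω.alternating x (u + v)
  simp only [map_add, LinearMap.add_apply, Ω.alternating] at h
  linarith

theorem bivector_eq (x : M) (a b : Module.Dual ℝ (E.Fiber x)) :
    Ω.bivector x a b = a (Ω.sharp x b) := by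
  rw [bivector, form_sharp]

theorem bivector_eq_neg (x : M) (a b : Module.Dual ℝ (E.Fiber x)) :
    Ω.bivector x a b = - b (Ω.sharp x a) := by
  rw [bivector, form_swap, form_sharp]

/-- Where the function `π(α, β)` is locally constant, the bracket `[α, β]` is
`X ↦ dα(X, π^♯ β) - dβ(X, π^♯ α)`. -/
theorem coBracket_eq_contr (α β : E.OneForm U) (X : E.fields) {x : M} {c : ℝ}
    (hc : ∀ᶠ y in nhds x, Ω.bivector y (α.toFun y) (β.toFun y) = c) :
    Ω.coBracket α β X x =
      α.contr X x (Ω.sharp x (β.toFun x)) - β.contr X x (Ω.sharp x (α.toFun x)) := by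
  have h : mvfderiv (𝓡 n) (fun y => Ω.bivector y (α.toFun y) (β.toFun y)) x = 0 :=
    mvfderiv_eq_zero_of_eventuallyEq_const hc
  rw [coBracket, lieBivector, h, bivector_eq, bivector_eq_neg, α.contr_apply, β.contr_apply]
  simp only [zero_apply]
  ring

section Split

variable {Ω} {k : ℕ} {α β : Fin k → E.OneForm U}

/-- For a splitting of length half the rank, the fibres have bases dual to `α, β`. -/
theorem IsSplit.exists_dual (h : Ω.IsSplit α β) {x : M} (hx : x ∈ U)
    (hr : Module.finrank ℝ (E.Fiber x) = 2 * k) :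
    ∃ e : Module.Basis (Fin k ⊕ Fin k) ℝ (E.Fiber x),
      ∀ i, (Sum.elim α β i).toFun x = e.coord i := by
  let Φ : E.Fiber x →ₗ[ℝ] (Fin k ⊕ Fin k → ℝ) :=
    LinearMap.pi fun i => (Sum.elim α β i).toFun x
  -- A vector killed by all `α i` and `β i` lies in the kernel of the form.
  have hinj : Function.Injective Φ := by
    rw [← LinearMap.ker_eq_bot, LinearMap.ker_eq_bot']
    intro u hu
    refine (Ω.nondegenerate x).1 ?_
    rw [map_zero]
    refine LinearMap.ext fun v => ?_
    have ha : ∀ i, (α i).toFun x u = 0 := fun i => congrFun hu (Sum.inl i)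
    have hb : ∀ i, (β i).toFun x u = 0 := fun i => congrFun hu (Sum.inr i)
    rw [h x hx u v]
    simp [ha, hb]
  -- The rank hypothesis alone does not give this when `k = 0`, since `finrank` is also zero in
  -- infinite dimension.
  have : FiniteDimensional ℝ (E.Fiber x) := FiniteDimensional.of_injective Φ hinj
  have hdim : Module.finrank ℝ (E.Fiber x) = Module.finrank ℝ (Fin k ⊕ Fin k → ℝ) := by
    simp [hr, two_mul]
  exact ⟨Module.Basis.ofEquivFun (LinearMap.linearEquivOfInjective Φ hinj hdim), fun i => rfl⟩

theorem IsSplit.form_inl (h : Ω.IsSplit α β) {x : M} (hx : x ∈ U)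
    (e : Module.Basis (Fin k ⊕ Fin k) ℝ (E.Fiber x))
    (he : ∀ i, (Sum.elim α β i).toFun x = e.coord i) (j : Fin k) :
    Ω.form x (e (Sum.inl j)) = (β j).toFun x := by
  have ha : ∀ i, (α i).toFun x = e.coord (Sum.inl i) := fun i => he (Sum.inl i)
  have hb : ∀ i, (β i).toFun x = e.coord (Sum.inr i) := fun i => he (Sum.inr i)
  refine LinearMap.ext fun v => ?_
  rw [h x hx]
  simp [ha, hb, Finsupp.single_apply]

theorem IsSplit.form_inr (h : Ω.IsSplit α β) {x : M} (hx : x ∈ U)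
    (e : Module.Basis (Fin k ⊕ Fin k) ℝ (E.Fiber x))
    (he : ∀ i, (Sum.elim α β i).toFun x = e.coord i) (j : Fin k) :
    Ω.form x (e (Sum.inr j)) = - (α j).toFun x := by
  have ha : ∀ i, (α i).toFun x = e.coord (Sum.inl i) := fun i => he (Sum.inl i)
  have hb : ∀ i, (β i).toFun x = e.coord (Sum.inr i) := fun i => he (Sum.inr i)
  refine LinearMap.ext fun v => ?_
  rw [h x hx]
  simp [ha, hb, Finsupp.single_apply]

/-- The functions `π(θ i, θ j)` of a splitting of length half the rank are constant. -/
theorem IsSplit.exists_bivector_eq (h : Ω.IsSplit α β)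
    (hr : ∀ x ∈ U, Module.finrank ℝ (E.Fiber x) = 2 * k) (i j : Fin k ⊕ Fin k) :
    ∃ c : ℝ, ∀ x ∈ U,
      Ω.bivector x ((Sum.elim α β i).toFun x) ((Sum.elim α β j).toFun x) = c := by
  rcases j with j | j
  · refine ⟨if Sum.inr j = i then -1 else 0, fun x hx => ?_⟩
    obtain ⟨e, he⟩ := h.exists_dual hx (hr x hx)
    have h1 : Ω.sharp x ((α j).toFun x) = - e (Sum.inr j) := by
      rw [← Ω.sharp_form x (- e (Sum.inr j)), map_neg (Ω.form x), h.form_inr hx e he, neg_neg]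
    rw [bivector_eq, he i, Sum.elim_inl, h1]
    simp only [map_neg, Module.Basis.coord_apply, Module.Basis.repr_self, Finsupp.single_apply]
    split_ifs <;> simp
  · refine ⟨if Sum.inl j = i then 1 else 0, fun x hx => ?_⟩
    obtain ⟨e, he⟩ := h.exists_dual hx (hr x hx)
    have h1 : Ω.sharp x ((β j).toFun x) = e (Sum.inl j) := by
      rw [← Ω.sharp_form x (e (Sum.inl j)), h.form_inl hx e he]
    rw [bivector_eq, he i, Sum.elim_inr, h1]
    simp only [Module.Basis.coord_apply, Module.Basis.repr_self, Finsupp.single_apply]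

theorem IsSplit.coBracket_eq (h : Ω.IsSplit α β)
    (hr : ∀ x ∈ U, Module.finrank ℝ (E.Fiber x) = 2 * k) (i j : Fin k ⊕ Fin k) {x : M}
    (hx : x ∈ U) (X : E.fields) :
    Ω.coBracket (Sum.elim α β i) (Sum.elim α β j) X x =
      (Sum.elim α β i).contr X x (Ω.sharp x ((Sum.elim α β j).toFun x))
        - (Sum.elim α β j).contr X x (Ω.sharp x ((Sum.elim α β i).toFun x)) := by
  obtain ⟨c, hc⟩ := h.exists_bivector_eq hr i j
  refine Ω.coBracket_eq_contr _ _ X (c := c) ?_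
  filter_upwards [U.isOpen.mem_nhds hx] with y hy using hc y hy

end Split

/-- Smooth one-forms which restrict to a basis of the dual of every fibre over `U` generate the
smooth sections of `A^*` over `U`. -/
theorem _root_.EGeom.InvolutiveModule.OneForm.exists_smooth_coeff {ι : Type*} [Fintype ι]
    (θ : ι → E.OneForm U)
    (hθ : ∀ x ∈ U, ∃ e : Module.Basis ι ℝ (E.Fiber x), ∀ i, (θ i).toFun x = e.coord i)
    (κ : E.OneForm U) :
    ∃ f : ι → M → ℝ, (∀ j, ContMDiffOn (𝓡 n) 𝓘(ℝ) ∞ (f j) U) ∧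
      ∀ x ∈ U, κ.toFun x = ∑ j, f j x • (θ j).toFun x := by
  classical
  have hex : ∀ x, ∃ g : ι → ℝ, x ∈ U → κ.toFun x = ∑ j, g j • (θ j).toFun x := by
    intro x
    by_cases hx : x ∈ U
    · obtain ⟨e, he⟩ := hθ x hx
      refine ⟨fun j => κ.toFun x (e j), fun _ => e.ext fun i => ?_⟩
      simp [he]
    · exact ⟨0, fun h => absurd h hx⟩
  choose g hg using hex
  refine ⟨fun j x => g x j, fun j x hx => ?_, hg⟩
  obtain ⟨e, he⟩ := hθ x hx
  -- Testing against elements of `E` that take the dual basis as values at `x` gives a linear system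
  -- for the coefficients, with smooth entries and the identity matrix at `x`.
  choose X hX using fun i => val_surjective x (e i)
  refine (contMDiffAt_of_mulVec_eq (A := fun y => Matrix.of fun i j => (θ j).app (X i) y)
    (b := fun y i => κ.app (X i) y) (fun i j => ?_) (fun i => ?_) ?_ ?_ j).contMDiffWithinAt
  · exact ((θ j).smooth (X i)).contMDiffAt (U.isOpen.mem_nhds hx)
  · exact (κ.smooth (X i)).contMDiffAt (U.isOpen.mem_nhds hx)
  · have : (Matrix.of fun i j => (θ j).app (X i) x) = (1 : Matrix ι ι ℝ) := by
      ext i j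
      simp [OneForm.app, hX, he, Matrix.one_apply, Finsupp.single_apply]
    rw [this]
    simp
  · filter_upwards [U.isOpen.mem_nhds hx] with y hy
    ext i
    simp only [Matrix.mulVec, dotProduct, Matrix.of_apply, OneForm.app, hg y hy]
    simp [mul_comm]

/-- The frame conditions hold for every such splitting by duality; only the commutation is tied to
closedness. -/
theorem IsSplit.isClosed_iff_isCommutativeFrame {Ω : E.SymplecticForm} {k : ℕ}
    {α β : Fin k → E.OneForm U} (h : Ω.IsSplit α β)
    (hr : ∀ x ∈ U, Module.finrank ℝ (E.Fiber x) = 2 * k) :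
    (∀ i, (α i).IsClosed ∧ (β i).IsClosed) ↔ Ω.IsCommutativeFrame (Sum.elim α β) := by
  have hd := fun x hx => h.exists_dual hx (hr x hx)
  have hcl : (∀ i, (α i).IsClosed ∧ (β i).IsClosed) ↔ ∀ i, (Sum.elim α β i).IsClosed := by
    simp [Sum.forall, forall_and]
  rw [hcl]
  constructor
  · intro hc
    simp only [OneForm.isClosed_iff_contr] at hc
    refine ⟨fun x hx => ?_, OneForm.exists_smooth_coeff _ hd, fun i j x hx X => ?_⟩
    · obtain ⟨e, he⟩ := hd x hx
      simp only [he]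
      exact e.linearIndependent_coord
    · rw [h.coBracket_eq hr i j hx X, hc i x hx, hc j x hx]
      simp
  · rintro ⟨-, -, hcomm⟩ i
    rw [OneForm.isClosed_iff_contr]
    intro x hx
    set θ := Sum.elim α β
    obtain ⟨e, he⟩ := hd x hx
    let b := (e.dualBasis).map (Ω.sharp x)
    have hb : ∀ j, b j = Ω.sharp x ((θ j).toFun x) := fun j => by
      rw [he j]; simp [b]
    -- The first slot of `contr` takes an element of `E`, so the basis vectors are extended to use
    -- antisymmetry.
    choose Y hY using fun j => val_surjective x (b j)
    have hsymm : ∀ i j X, (θ i).contr X x (b j) = (θ j).contr X x (b i) := by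
      intro i j X
      have := hcomm i j x hx X
      rw [h.coBracket_eq hr i j hx X, ← hb, ← hb] at this
      linarith
    have hanti : ∀ i j l, (θ i).contr (Y j) x (b l) = - (θ i).contr (Y l) x (b j) := by
      intro i j l
      rw [← hY l, (θ i).contr_swap _ _ hx, hY j]
    have hzero : ∀ j, (θ i).contr (Y j) x = 0 := by
      intro j
      refine b.ext fun l => ?_
      -- Alternating the symmetry and the antisymmetry returns to the initial term after three sign
      -- changes, so it equals its own negative.
      have h1 := hsymm i l (Y j)
      have h2 := hanti l j i
      have h3 := hsymm l j (Y i)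
      have h4 := hanti j i l
      have h5 := hsymm j i (Y l)
      have h6 := hanti i l j
      rw [LinearMap.zero_apply]
      linarith
    intro X
    refine b.ext fun l => ?_
    rw [← hY l, (θ i).contr_swap _ _ hx, hzero l]
    simp

end SymplecticForm

end InvolutiveModule

/-! ### Vector fields and defining functions of hypersurfaces -/

variable (n M) in
/-- The smooth vector fields on `M`. -/
abbrev SmoothField : Type _ := (zeroModule n (∅ : Set M)).fields

/-- Used when `n = 1` with `l = dh`, to relate two vector fields without dividing. -/
theorem smul_apply_comm_of_finrank_eq_one {T : Type*} [AddCommGroup T] [Module ℝ T]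
    (hT : Module.finrank ℝ T = 1) (l : T →ₗ[ℝ] ℝ) (u v : T) : l v • u = l u • v := by
  obtain ⟨e, -, he⟩ := finrank_eq_one_iff'.1 hT
  obtain ⟨a, rfl⟩ := he u
  obtain ⟨b, rfl⟩ := he v
  simp only [map_smul, smul_eq_mul, smul_smul]
  congr 1
  ring

/-- A tangent vector extends to a smooth vector field. -/
theorem exists_smooth_vectorField [T2Space M] {p : M} (v : TangentSpace (𝓡 n) p) :
    ∃ V : SmoothField n M, (V : VField n M) p = v := by
  have : IsManifold (𝓡 n) (((⊤ : ℕ∞) : WithTop ℕ∞) + 1) M := by simpa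
  obtain ⟨s, hs, hV⟩ := FiberBundle.exists_contMDiffOn_extend (k := ∞) (𝓡 n)
    (EuclideanSpace ℝ (Fin n)) (V := TangentSpace (𝓡 n)) v
  obtain ⟨f, hf, -⟩ :=
    (SmoothBumpFunction.nhds_basis_support (I := 𝓡 n) (interior_mem_nhds.2 hs)).mem_iff.1
      (interior_mem_nhds.2 hs)
  refine ⟨⟨(f : M → ℝ) • FiberBundle.extend (EuclideanSpace ℝ (Fin n)) v, ?_, by simp⟩, ?_⟩
  · exact ContMDiffOn.smul_section_of_tsupport (f.contMDiff.contMDiffOn (s := interior s))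
      isOpen_interior hf (hV.mono interior_subset)
  · simp

/-- A hypersurface has, near each of its points, a defining function which is defined on the whole
manifold. -/
theorem IsHypersurface.exists_defining_function [T2Space M] {Z : Set M} (hZ : IsHypersurface n Z)
    {p : M} (hp : p ∈ Z) :
    ∃ h : M → ℝ, ContMDiff (𝓡 n) 𝓘(ℝ) ∞ h ∧ (∀ x ∈ Z, h x = 0) ∧ mvfderiv (𝓡 n) h p ≠ 0 := by
  obtain ⟨φ, hφ, hpφ, i, hi⟩ := hZ p hp
  have hs : φ.source ∈ nhds p := φ.open_source.mem_nhds hpφ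
  obtain ⟨f, hf, -⟩ := (SmoothBumpFunction.nhds_basis_support (I := 𝓡 n) hs).mem_iff.1 hs
  have hcoord : ContMDiff (𝓡 n) 𝓘(ℝ) ∞ (fun y : EuclideanSpace ℝ (Fin n) => y i) :=
    (EuclideanSpace.proj (𝕜 := ℝ) i).contDiff.contMDiff
  -- The bump function extends the coordinate to `M` and equals one near `p`, so the differential at
  -- `p` is unchanged.
  let h : M → ℝ := fun x => f x * φ x i
  have hsm : ContMDiff (𝓡 n) 𝓘(ℝ) ∞ h := by
    refine contMDiff_of_tsupport fun x hx => ?_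
    have hx' : x ∈ φ.source := hf (tsupport_mul_subset_left hx)
    exact f.contMDiffAt.mul ((hcoord _).comp x (contMDiffAt_of_mem_maximalAtlas hφ hx'))
  refine ⟨h, hsm, fun x hx => ?_, fun h0 => ?_⟩
  · by_cases hx' : x ∈ φ.source
    · simp [h, (hi x hx').1 hx]
    · have : f x = 0 := image_eq_zero_of_notMem_tsupport fun hx'' => hx' (hf hx'')
      simp [h, this]
  · have hpt : φ p ∈ φ.target := φ.map_source hpφ
    have hsymm : MDifferentiableAt (𝓡 n) (𝓡 n) φ.symm (φ p) :=
      (contMDiffAt_symm_of_mem_maximalAtlas hφ hpt).mdifferentiableAt (by simp)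
    have hinv : φ.symm (φ p) = p := φ.left_inv hpφ
    have heq : (h ∘ φ.symm) =ᶠ[nhds (φ p)] fun y => y i := by
      have hcont : Filter.Tendsto φ.symm (nhds (φ p)) (nhds p) := by
        have := (φ.continuousAt_symm hpt).tendsto
        rwa [hinv] at this
      filter_upwards [hcont.eventually f.eventuallyEq_one, φ.open_target.mem_nhds hpt] with y h1 h2
      simp only [h, Function.comp_apply, φ.right_inv h2]
      rw [h1]
      simp
    have h1 : mfderiv (𝓡 n) 𝓘(ℝ) (h ∘ φ.symm) (φ p) = 0 := by
      have h2 : mfderiv (𝓡 n) 𝓘(ℝ) h p = 0 := h0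
      rw [mfderiv_comp_of_eq (hsm.mdifferentiableAt (by simp)) hsymm hinv, hinv, h2]
      exact ContinuousLinearMap.zero_comp _
    have h3 := congrArg (fun L => L (EuclideanSpace.single i (1 : ℝ))) h1
    rw [heq.mfderiv_eq, mfderiv_eq_fderiv] at h3
    have h4 : fderiv ℝ (fun y : EuclideanSpace ℝ (Fin n) => y i) (φ p) = EuclideanSpace.proj i :=
      (EuclideanSpace.proj (𝕜 := ℝ) i).fderiv
    rw [h4] at h3
    have h5 : (EuclideanSpace.single i (1 : ℝ)) i = 0 := h3
    simp at h5

namespace InvolutiveModule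

variable {E : InvolutiveModule n M}

/-- The Lie bracket with a smooth vector field descends to the fibre at a point where all elements
of `E` vanish. -/
theorem mlieBracket_eq_zero_of_val_eq_zero {V : VField n M} {p : M}
    (hE : ∀ X : E.fields, (X : VField n M) p = 0) {X : E.fields} (hX : E.val p X = 0) :
    VectorField.mlieBracket (𝓡 n) V (X : VField n M) p = 0 := by
  replace hX : X ∈ E.idealMul p := (Submodule.Quotient.mk_eq_zero _).1 hX
  induction hX using Submodule.span_induction with
  | mem Y hY =>
    obtain ⟨f, hf, X, hfp, rfl⟩ := hY
    have := VectorField.mlieBracket_smul_right (V := V) (x := p)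
      (hf.mdifferentiableAt (x := p) (by simp)) (fields_mdifferentiableAt X p)
    change VectorField.mlieBracket (𝓡 n) V (f • (X : VField n M)) p = 0
    -- In the Leibniz rule one term contains `X p = 0` and the other `f p = 0`.
    rw [this, hE X, hfp]
    simp
  | zero => exact congrFun VectorField.mlieBracket_zero_right p
  | add X Y _ _ hX hY =>
    have := VectorField.mlieBracket_add_right (V := V) (fields_mdifferentiableAt X p)
      (fields_mdifferentiableAt Y p)
    exact this.trans (by rw [hX, hY, add_zero])
  | smul c X _ hX =>
    have := VectorField.mlieBracket_const_smul_right (V := V) (c := c)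
      (fields_mdifferentiableAt X p)
    exact this.trans (by rw [hX, smul_zero])

end InvolutiveModule

open InvolutiveModule

/-! ### Vector fields vanishing along a hypersurface -/

section ZeroModule

/-- The product of a smooth function vanishing along `Z` and a smooth vector field, as an element of
the module of vector fields vanishing along `Z`. -/
def zeroSMul {Z : Set M} {h : M → ℝ} (hh : ContMDiff (𝓡 n) 𝓘(ℝ) ∞ h) (hZ : ∀ x ∈ Z, h x = 0)
    (V : SmoothField n M) : (zeroModule n Z).fields :=
  ⟨h • (V : VField n M), hh.smul_section V.2.1, fun x hx => by simp [hZ x hx]⟩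

variable {Z : Set M} {h : M → ℝ} (hh : ContMDiff (𝓡 n) 𝓘(ℝ) ∞ h) (hZ : ∀ x ∈ Z, h x = 0)
  {V W : SmoothField n M} {p : M}

/-- The map `X ↦ [V, X](p)` descends to the fibre and sends `hW` to `dh(V) W = W` at `p`. This
detects nonzero values without computing the fibre. -/
theorem val_zeroSMul_ne_zero (hp : p ∈ Z)
    (hVp : mvfderiv (𝓡 n) h p ((V : VField n M) p) = 1) (hWp : (W : VField n M) p ≠ 0) :
    (zeroModule n Z).val p (zeroSMul hh hZ W) ≠ 0 := by
  intro h0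
  have h1 := mlieBracket_eq_zero_of_val_eq_zero (E := zeroModule n Z) (V := (V : VField n M))
    (fun X => X.2.2 p hp) h0
  have h2 := VectorField.mlieBracket_smul_right (V := (V : VField n M)) (x := p)
    (hh.mdifferentiableAt (x := p) (by simp)) (fields_mdifferentiableAt W p)
  have h3 := h2.symm.trans h1
  rw [hVp, hZ p hp, one_smul, zero_smul, add_zero] at h3
  exact hWp h3

theorem lie_zeroSMul : (zeroModule n Z).lie (zeroSMul hh hZ V) (zeroSMul hh hZ W) =
    (zeroModule n Z).fsmul _ (contMDiff_derivative h hh V) (zeroSMul hh hZ W)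
      - (zeroModule n Z).fsmul _ (contMDiff_derivative h hh W) (zeroSMul hh hZ V)
      + (zeroModule n Z).fsmul h hh (zeroSMul hh hZ ((zeroModule n ∅).lie V W)) := by
  ext1
  funext x
  have hd := hh.mdifferentiableAt (x := x) (by simp)
  have h1 := VectorField.mlieBracket_smul_right (V := h • (V : VField n M)) hd
    (fields_mdifferentiableAt W x)
  have h2 := VectorField.mlieBracket_smul_left (W := (W : VField n M)) hd
    (fields_mdifferentiableAt V x)
  refine h1.trans ?_
  rw [h2]
  change _ = (mvfderiv (𝓡 n) h x ((V : VField n M) x) • h x • (W : VField n M) x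
    - mvfderiv (𝓡 n) h x ((W : VField n M) x) • h x • (V : VField n M) x)
    + h x • h x • VectorField.mlieBracket (𝓡 n) (V : VField n M) (W : VField n M) x
  simp only [Pi.smul_apply', map_smul, smul_eq_mul]
  module
-- In `[hV, hW] = V(h) hW - W(h) hV + h (h[V, W])` the coefficients at `p` are `1`, `0` and `0`.
theorem val_lie_zeroSMul (hp : p ∈ Z) (hVp : mvfderiv (𝓡 n) h p ((V : VField n M) p) = 1)
    (hWp : mvfderiv (𝓡 n) h p ((W : VField n M) p) = 0) :
    (zeroModule n Z).val p ((zeroModule n Z).lie (zeroSMul hh hZ V) (zeroSMul hh hZ W)) =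
      (zeroModule n Z).val p (zeroSMul hh hZ W) := by
  rw [lie_zeroSMul, map_add, map_sub, val_fsmul, val_fsmul, val_fsmul, hVp, hWp, hZ p hp]
  simp

/-- A closed one-form annihilates brackets at a point where all elements of `E` vanish. -/
theorem InvolutiveModule.OneForm.IsClosed.app_lie {E : InvolutiveModule n M}
    {U : TopologicalSpace.Opens M} {α : E.OneForm U} (hα : α.IsClosed) {p : M} (hp : p ∈ U)
    (hE : ∀ X : E.fields, (X : VField n M) p = 0) (X Y : E.fields) :
    α.toFun p (E.val p (E.lie X Y)) = 0 := by
  have h := hα p hp X Y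
  rw [hE X, hE Y, map_zero, map_zero] at h
  simpa [OneForm.app] using h

/-- There is no symplectic form for the module of vector fields vanishing along a hypersurface of a
one-dimensional manifold. -/
theorem not_symplecticForm_of_dim_one (hh : ContMDiff (𝓡 n) 𝓘(ℝ) ∞ h)
    (hZ : ∀ x ∈ Z, h x = 0) (hn : n = 1) (hp : p ∈ Z)
    (hVp : mvfderiv (𝓡 n) h p ((V : VField n M) p) = 1)
    (Ω : (zeroModule n Z).SymplecticForm) : False := by
  set Y := zeroSMul hh hZ V
  have hVsm := contMDiff_derivative h hh V
  have hVp0 : (V : VField n M) p ≠ 0 := fun h0 => by simp [h0] at hVp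
  have hVev : ∀ᶠ x in nhds p, mvfderiv (𝓡 n) h x ((V : VField n M) x) ≠ 0 :=
    hVsm.continuous.continuousAt.eventually_ne (by rw [hVp]; exact one_ne_zero)
  -- Otherwise `h` would vanish near `p`, contradicting `dh(V) = 1` there.
  have hfreq : ∃ᶠ x in nhds p, h x ≠ 0 := by
    intro h0
    have h1 : h =ᶠ[nhds p] fun _ => 0 := by
      filter_upwards [h0] with x hx using not_not.1 hx
    have h3 : mvfderiv (𝓡 n) h p ((V : VField n M) p) = 0 := by
      rw [mvfderiv_eq_zero_of_eventuallyEq_const h1]; rfl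
    rw [hVp] at h3
    exact one_ne_zero h3
  refine val_zeroSMul_ne_zero hh hZ hp hVp hVp0 ((Ω.nondegenerate p).1 ?_)
  rw [map_zero]
  refine LinearMap.ext fun v => ?_
  obtain ⟨X, rfl⟩ := val_surjective p v
  have hdim : Module.finrank ℝ (EuclideanSpace ℝ (Fin n)) = 1 := by simp [hn]
  have hXY : (zeroModule n Z).fsmul _ (contMDiff_derivative h hh Y) X =
      (zeroModule n Z).fsmul _ (contMDiff_derivative h hh X) Y := by
    ext1
    funext x
    exact smul_apply_comm_of_finrank_eq_one hdim (mvfderiv (𝓡 n) h x).toLinearMap _ _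
  -- Pairing `Y(h) X = X(h) Y` with `Y` gives `Y(h) Ω(Y, X) = 0`, and `Y(h) = h V(h)` is nonzero at
  -- points arbitrarily near `p`.
  have hzero : ∃ᶠ x in nhds p, Ω.form x ((zeroModule n Z).val x Y) ((zeroModule n Z).val x X) = 0 := by
    refine (hfreq.and_eventually hVev).mono fun x hx => ?_
    have h1 := congrArg (fun T => Ω.form x ((zeroModule n Z).val x Y) ((zeroModule n Z).val x T)) hXY
    simp only [val_fsmul, map_smul, Ω.alternating, smul_eq_mul, mul_zero] at h1
    refine (mul_eq_zero.1 h1).resolve_left ?_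
    have h2 : mvfderiv (𝓡 n) h x ((Y : VField n M) x) =
        h x * mvfderiv (𝓡 n) h x ((V : VField n M) x) := by
      change mvfderiv (𝓡 n) h x (h x • (V : VField n M) x) = _
      simp
    rw [h2]
    exact mul_ne_zero hx.1 hx.2
  have hcont : ContinuousAt (fun x => Ω.form x ((zeroModule n Z).val x Y)
      ((zeroModule n Z).val x X)) p := (Ω.smooth Y X).continuous.continuousAt
  by_contra hne
  exact hzero (hcont.eventually_ne hne)

theorem not_exists_closed_splitting [T2Space M] (hypZ : IsHypersurface n Z)
    (Ω : (zeroModule n Z).SymplecticForm) {U : TopologicalSpace.Opens M}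
    (hU : (Z ∩ U).Nonempty) {k : ℕ} (α β : Fin k → (zeroModule n Z).OneForm U)
    (hs : Ω.IsSplit α β) (hc : ∀ i, (α i).IsClosed ∧ (β i).IsClosed) : False := by
  obtain ⟨p, hpZ, hpU⟩ := hU
  obtain ⟨h, hh, hZ, hne⟩ := hypZ.exists_defining_function hpZ
  obtain ⟨v, hv⟩ : ∃ v, mvfderiv (𝓡 n) h p v = 1 := by
    obtain ⟨u, hu⟩ : ∃ u, mvfderiv (𝓡 n) h p u ≠ 0 := by
      by_contra! h0
      exact hne (ContinuousLinearMap.ext h0)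
    exact ⟨(mvfderiv (𝓡 n) h p u)⁻¹ • u, by simp [hu]⟩
  obtain ⟨V, hV⟩ := exists_smooth_vectorField v
  rw [← hV] at hv
  by_cases hn : n = 1
  · exact not_symplecticForm_of_dim_one hh hZ hn hpZ hv Ω
  obtain ⟨w, hw, hw0⟩ : ∃ w, mvfderiv (𝓡 n) h p w = 0 ∧ w ≠ 0 := by
    by_contra! h0
    have hinj : Function.Injective (mvfderiv (𝓡 n) h p) :=
      (injective_iff_map_eq_zero _).2 h0
    have h1 : Module.finrank ℝ (EuclideanSpace ℝ (Fin n)) ≤ Module.finrank ℝ ℝ :=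
      LinearMap.finrank_le_finrank_of_injective (f := (mvfderiv (𝓡 n) h p).toLinearMap) hinj
    rw [finrank_euclideanSpace_fin, Module.finrank_self] at h1
    -- Dimension one is already excluded; in dimension zero `V` vanishes, against `dh(V) = 1`.
    obtain rfl : n = 0 := by omega
    have : (V : VField 0 M) p = 0 := Subsingleton.elim (α := EuclideanSpace ℝ (Fin 0)) _ _
    rw [this, map_zero] at hv
    exact zero_ne_one hv
  obtain ⟨W, hW⟩ := exists_smooth_vectorField w
  rw [← hW] at hw hw0
  have hE : ∀ X : (zeroModule n Z).fields, (X : VField n M) p = 0 := fun X => X.2.2 p hpZ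
  refine val_zeroSMul_ne_zero hh hZ hpZ hv hw0 ((Ω.nondegenerate p).1 ?_)
  rw [map_zero]
  refine LinearMap.ext fun u => ?_
  -- Once `hW` is written as a bracket, every term of the splitting contains a closed form evaluated
  -- on that bracket.
  rw [← val_lie_zeroSMul hh hZ hpZ hv hw, hs p hpU]
  simp [(hc _).1.app_lie hpU hE, (hc _).2.app_lie hpU hE]

end ZeroModule

end EGeom

theorem mainTheorem10 {n : ℕ} {M : Type*} [TopologicalSpace M] [T2Space M]
    [SecondCountableTopology M] [ChartedSpace (EuclideanSpace ℝ (Fin n)) M]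
    [IsManifold (𝓡 n) ∞ M] :
    (∀ E : EGeom.InvolutiveModule n M, E.IsAlmostRegular →
      ∀ (Ω : E.SymplecticForm) (U : TopologicalSpace.Opens M) (k : ℕ),
        (∀ x ∈ U, Module.finrank ℝ (E.Fiber x) = 2 * k) →
        ∀ α β : Fin k → E.OneForm U, Ω.IsSplit α β →
          ((∀ i, (α i).IsClosed ∧ (β i).IsClosed) ↔
            Ω.IsCommutativeFrame (Sum.elim α β))) ∧
    (∀ Z : Set M, EGeom.IsHypersurface n Z →
      ∀ (Ω : (EGeom.zeroModule n Z).SymplecticForm) (U : TopologicalSpace.Opens M),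
        (Z ∩ U).Nonempty → ∀ k : ℕ,
          ¬ ∃ α β : Fin k → (EGeom.zeroModule n Z).OneForm U,
            Ω.IsSplit α β ∧ ∀ i, (α i).IsClosed ∧ (β i).IsClosed) := by
  refine ⟨fun E _ Ω U k hr α β hs => hs.isClosed_iff_isCommutativeFrame hr, ?_⟩
  rintro Z hZ Ω U hU k ⟨α, β, hs, hc⟩
  exact EGeom.not_exists_closed_splitting hZ Ω hU α β hs hc
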